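/- Let $(H,\rho)$ be a complete $\mathrm{CAT}(0)$ space. For $p,q\in H$ let $\gamma_{p,q}:[0,1]\to H$ be the unique constant-speed geodesic from $p$ to $q$ (constant if $p=q$). The Alexandrov angle of two such geodesics issuing from $p$ is the limit of the comparison angles $\overline{\angle}_p(\gamma_1(s),\gamma_2(t))$ as $s,t\to0^+$, where by convention $\overline{\angle}_p(p,p)=0$ and $\overline{\angle}_p(p,r)=\overline{\angle}_p(r,p)=\pi/2$ for $r\neq p$. It is a pseudometric on the set of these geodesics; let $(S_p,\angle_p)$ be its metric identification, and put $\zeta(\gamma)=0$ if $\gamma$ is the constant geodesic and $\zeta(\gamma)=1$ otherwise. The tangent space $T_pH$ is the quotient of $[0,\infty)\times S_p$ in which $(t_1,\gamma_1)$ and $(t_2,\gamma_2)$ are identified if $t_1\zeta(\gamma_1)=t_2\zeta(\gamma_2)=0$, or if $t_1\zeta(\gamma_1)=t_2\zeta(\gamma_2)>0$ and $\gamma_1=\gamma_2$; the class of $(t,\gamma)$ is written $t\gamma$, and $\gamma$ for $t=1$. Put $$g_p(t_1\gamma_1,t_2\gamma_2)=t_1t_2\,\zeta(\gamma_1)\zeta(\gamma_2)\cos\angle_p(\gamma_1,\gamma_2).$$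 A vector field $A$ on $H$ assigns to each $p\in H$ a (possibly empty) set $Ap\subset T_pH$; its domain is $\operatorname{dom}A=\{p\in H: Ap\neq\emptyset\}$. It is monotone if $g_p(\eta,\gamma_{p,q})\le -g_q(\nu,\gamma_{q,p})$ for all $p,q\in H$, $\eta\in Ap$, $\nu\in Aq$. It satisfies the surjectivity condition if for all $t>0$ and $x\in H$ there is $p\in H$ with $t\rho(p,x)\gamma_{p,x}\in Ap$. For $\lambda>0$ its resolvent is $J_\lambda x=\{z\in H:\lambda^{-1}\rho(z,x)\gamma_{z,x}\in Az\}$. **Theorem.** Suppose that $H$ has the geodesic extension property (every unit speed geodesic $[0,L]\to H$ with $L>0$ extends to an isometric embedding $\mathbb R\to H$), and that $A$ is a monotone vector field on $H$ with the surjectivity condition. Then for every $x\in H$ the set $J_\lambda x$ is a singleton for each $\lambda>0$, there is a unique point $P_{\overline{\operatorname{dom}A}}\,x$ of $\overline{\operatorname{dom}A}$ nearest to $x$, and (identifying the singleton $J_\lambda x$ with its element) $$\lim_{\lambda\to0^+}J_\lambda x=P_{\overline{\operatorname{dom}A}}\,x .$$ -/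

import Mathlib

open Filter Topology
open scoped NNReal unitInterval

namespace Hadamard

/-! ### Geodesics and CAT(0) spaces -/

/-- A normalized geodesic issuing from `p`: a map `c : [0,1] → X` with `c 0 = p` and
`d (c s) (c t) = K * |s - t|`; the constant `K` is necessarily the distance of the end points.
The zero geodesic (`K = 0`) is allowed. -/
@[ext]
structure NGeod (X : Type*) [MetricSpace X] (p : X) where
  toFun : I → X
  start : toFun 0 = p
  dist_eq : ∀ s t : I, dist (toFun s) (toFun t) = dist p (toFun 1) * |(s : ℝ) - t|

/-- The point in which a normalized geodesic ends. -/
def NGeod.target {X : Type*} [MetricSpace X] {p : X} (c : NGeod X p) : X := c.toFun 1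

/-- The zero geodesic at `p`. -/
def NGeod.zero {X : Type*} [MetricSpace X] (p : X) : NGeod X p where
  toFun _ := p
  start := rfl
  dist_eq s t := by simp

/-- A CAT(0) space: a geodesic metric space in which all geodesic triangles are at least as thin as
their comparison triangles in the Euclidean plane.
Two points of a geodesic triangle that do not lie on a common side lie on two sides that share a
vertex, which is called `p` here (for two points on a common side the inequality is trivial). The
comparison point of `c₁ s` is the point that divides the segment from `p'` to `q'` in the ratio
`s : 1 - s`, and likewise for `c₂ t`. -/
class CAT0Space (X : Type*) [MetricSpace X] : Prop where
  exists_geodesic : ∀ p q : X, ∃ c : NGeod X p, c.target = q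
  thin : ∀ (p q r : X) (c₁ c₂ : NGeod X p), c₁.target = q → c₂.target = r →
    ∀ p' q' r' : EuclideanSpace ℝ (Fin 2),
      dist p' q' = dist p q → dist q' r' = dist q r → dist r' p' = dist r p →
      ∀ s t : I, dist (c₁.toFun s) (c₂.toFun t) ≤
        dist (AffineMap.lineMap p' q' (s : ℝ)) (AffineMap.lineMap p' r' (t : ℝ))

/-- The normalized geodesic `γ_{p,q}` from `p` to `q` (it is unique in a CAT(0) space). -/
noncomputable def geod {X : Type*} [MetricSpace X] [CAT0Space X] (p q : X) : NGeod X p :=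
  (CAT0Space.exists_geodesic p q).choose

/-- The geodesic extension property: every nondegenerate unit speed geodesic `c : [0,L] → X`
extends to an isometric embedding of the real line. -/
def GeodesicExtension (X : Type*) [MetricSpace X] : Prop :=
  ∀ (L : ℝ) (c : Set.Icc (0 : ℝ) L → X), 0 < L → Isometry c →
    ∃ η : ℝ → X, Isometry η ∧ ∀ t : Set.Icc (0 : ℝ) L, η t = c t

/-! ### Angles -/

open Classical in
/-- The comparison angle at `p` between `q` and `r`. For `q, r ≠ p` it is the angle at the vertex
corresponding to `p` of a Euclidean comparison triangle (law of cosines); if exactly one of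
`q`, `r` is `p` it is `π / 2`, and if both are it is `0`. -/
noncomputable def compAngle {X : Type*} [MetricSpace X] (p q r : X) : ℝ :=
  if q = p ∧ r = p then 0
  else if q = p ∨ r = p then Real.pi / 2
  else Real.arccos ((dist p q ^ 2 + dist p r ^ 2 - dist q r ^ 2) / (2 * dist p q * dist p r))

/-- The Alexandrov angle between two geodesics issuing from `p`: the upper limit of the comparison
angles at `p` between `c₁ s` and `c₂ t` as `s, t → 0⁺`. (In a CAT(0) space the comparison angle is
monotone in `s` and `t`, and the upper limit is a limit.) -/
noncomputable def angle {X : Type*} [MetricSpace X] {p : X} (c₁ c₂ : NGeod X p) : ℝ :=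
  limsup (fun st : I × I => compAngle p (c₁.toFun st.1) (c₂.toFun st.2))
    (𝓝[>] (0 : I) ×ˢ 𝓝[>] (0 : I))

section AngleFacts

variable {X : Type*} [MetricSpace X] {p : X}

theorem compAngle_nonneg (p q r : X) : 0 ≤ compAngle p q r := by
  unfold compAngle
  split_ifs
  · exact le_rfl
  · positivity
  · exact Real.arccos_nonneg _

theorem compAngle_le_pi (p q r : X) : compAngle p q r ≤ Real.pi := by
  unfold compAngle
  split_ifs
  · exact Real.pi_pos.le
  · linarith [Real.pi_pos]
  · exact Real.arccos_le_pi _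

theorem compAngle_comm (p q r : X) : compAngle p q r = compAngle p r q := by
  unfold compAngle
  by_cases hq : q = p <;> by_cases hr : r = p <;>
    simp [hq, hr, dist_comm q r, add_comm (dist p q ^ 2), mul_right_comm 2 (dist p q)]

/-- The law of cosines for the comparison angle. -/
theorem cos_compAngle {p q r : X} (hq : q ≠ p) (hr : r ≠ p) :
    dist q r ^ 2 =
      dist p q ^ 2 + dist p r ^ 2 - 2 * dist p q * dist p r * Real.cos (compAngle p q r) := by
  have ha : 0 < dist p q := dist_pos.2 hq.symm
  have hb : 0 < dist p r := dist_pos.2 hr.symm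
  have h1 := dist_triangle p q r
  have h2 := dist_triangle p r q
  have h3 := dist_triangle_left q r p
  rw [dist_comm r q] at h2
  have hc : 0 ≤ dist q r := dist_nonneg
  have hpos : 0 < 2 * dist p q * dist p r := by positivity
  unfold compAngle
  rw [if_neg (by tauto), if_neg (by tauto), Real.cos_arccos]
  · field_simp
    ring
  · rw [le_div_iff₀ hpos]
    nlinarith
  · rw [div_le_one hpos]
    nlinarith [mul_nonneg (sub_nonneg.2 h1) (sub_nonneg.2 h2)]

instance neBot_right : (𝓝[>] (0 : I)).NeBot := nhdsGT_neBot_of_exists_gt ⟨1, zero_lt_one⟩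

theorem bdd_above (c₁ c₂ : NGeod X p) :
    IsBoundedUnder (· ≤ ·) (𝓝[>] (0 : I) ×ˢ 𝓝[>] (0 : I))
      (fun st : I × I => compAngle p (c₁.toFun st.1) (c₂.toFun st.2)) :=
  isBoundedUnder_of ⟨Real.pi, fun _ => compAngle_le_pi _ _ _⟩

theorem cobdd_above (c₁ c₂ : NGeod X p) :
    IsCoboundedUnder (· ≤ ·) (𝓝[>] (0 : I) ×ˢ 𝓝[>] (0 : I))
      (fun st : I × I => compAngle p (c₁.toFun st.1) (c₂.toFun st.2)) :=
  (isBoundedUnder_of ⟨0, fun _ => compAngle_nonneg _ _ _⟩ :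
    IsBoundedUnder (· ≥ ·) _ _).isCoboundedUnder_le

theorem angle_nonneg (c₁ c₂ : NGeod X p) : 0 ≤ angle c₁ c₂ :=
  le_limsup_of_frequently_le
    (Frequently.of_forall fun _ => compAngle_nonneg _ _ _) (bdd_above c₁ c₂)

theorem angle_le_pi (c₁ c₂ : NGeod X p) : angle c₁ c₂ ≤ Real.pi :=
  limsup_le_of_le (cobdd_above c₁ c₂) (Eventually.of_forall fun _ => compAngle_le_pi _ _ _)

theorem eventually_pos : ∀ᶠ st : I × I in 𝓝[>] (0 : I) ×ˢ 𝓝[>] (0 : I), 0 < st.1 ∧ 0 < st.2 :=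
  (eventually_mem_nhdsWithin : ∀ᶠ s : I in 𝓝[>] (0 : I), s ∈ Set.Ioi 0).prod_mk
    (eventually_mem_nhdsWithin : ∀ᶠ s : I in 𝓝[>] (0 : I), s ∈ Set.Ioi 0)

theorem NGeod.dist_start (c : NGeod X p) (s : I) :
    dist p (c.toFun s) = dist p c.target * s := by
  have h := c.dist_eq 0 s
  rw [c.start] at h
  rw [h, NGeod.target]
  simp [abs_of_nonneg s.2.1]

theorem NGeod.toFun_ne (c : NGeod X p) (hc : c.target ≠ p) {s : I} (hs : 0 < s) :
    c.toFun s ≠ p := by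
  have h := c.dist_start s
  have : 0 < dist p (c.toFun s) := by
    rw [h]
    exact mul_pos (dist_pos.2 hc.symm) hs
  exact (dist_pos.1 this).symm

theorem NGeod.toFun_eq (c : NGeod X p) (hc : c.target = p) (s : I) : c.toFun s = p := by
  have h := c.dist_start s
  rw [hc, dist_self, zero_mul] at h
  exact (dist_eq_zero.1 h).symm

theorem angle_eq_of_forall {c₁ c₂ : NGeod X p} {a : ℝ}
    (h : ∀ s t : I, 0 < s → 0 < t → compAngle p (c₁.toFun s) (c₂.toFun t) = a) :
    angle c₁ c₂ = a := by
  have : (fun st : I × I => compAngle p (c₁.toFun st.1) (c₂.toFun st.2))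
      =ᶠ[𝓝[>] (0 : I) ×ˢ 𝓝[>] (0 : I)] fun _ => a := by
    filter_upwards [eventually_pos] with st hst
    exact h _ _ hst.1 hst.2
  rw [angle, limsup_congr this, limsup_const]

theorem angle_zero_zero {c₁ c₂ : NGeod X p} (h₁ : c₁.target = p) (h₂ : c₂.target = p) :
    angle c₁ c₂ = 0 :=
  angle_eq_of_forall fun s t _ _ => by simp [compAngle, c₁.toFun_eq h₁, c₂.toFun_eq h₂]

theorem angle_zero_left {c₁ c₂ : NGeod X p} (h₁ : c₁.target = p) (h₂ : c₂.target ≠ p) :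
    angle c₁ c₂ = Real.pi / 2 :=
  angle_eq_of_forall fun s t _ ht => by
    simp [compAngle, c₁.toFun_eq h₁, c₂.toFun_ne h₂ ht]

theorem angle_comm (c₁ c₂ : NGeod X p) : angle c₁ c₂ = angle c₂ c₁ := by
  unfold angle
  conv_lhs => rw [Filter.prod_comm]
  rw [Filter.limsup, Filter.map_map, Filter.limsup]
  congr 2
  funext st
  exact compAngle_comm _ _ _

theorem angle_self (c : NGeod X p) : angle c c = 0 := by
  by_cases hc : c.target = p
  · exact angle_zero_zero hc hc
  refine angle_eq_of_forall fun s t hs ht => ?_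
  have hK : 0 < dist p c.target := dist_pos.2 (Ne.symm hc)
  have hs' : 0 < (s : ℝ) := hs
  have ht' : 0 < (t : ℝ) := ht
  rw [compAngle, if_neg (by simp [c.toFun_ne hc hs]),
    if_neg (by simp [c.toFun_ne hc hs, c.toFun_ne hc ht]), c.dist_start, c.dist_start,
    c.dist_eq, mul_pow, mul_pow, mul_pow, sq_abs]
  rw [← Real.arccos_one]
  congr 1
  change (_ + _ - dist p c.target ^ 2 * _) / _ = 1
  rw [div_eq_one_iff_eq (by positivity)]
  ring

/-- Splitting an angle of a Euclidean triangle: the point of the opposite side on the ray that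
divides the angle `α + β` into `α` and `β`. -/
theorem euclid_split {a b α β : ℝ} (ha : 0 < a) (hb : 0 < b) (hα : 0 < α) (hβ : 0 < β)
    (hs : α + β < Real.pi) : ∃ t, 0 < t ∧ t ≤ max a b ∧
      √(a ^ 2 + t ^ 2 - 2 * a * t * Real.cos α) + √(t ^ 2 + b ^ 2 - 2 * t * b * Real.cos β) ≤
        √(a ^ 2 + b ^ 2 - 2 * a * b * Real.cos (α + β)) := by
  have sα : 0 < Real.sin α := Real.sin_pos_of_pos_of_lt_pi hα (by linarith)
  have sβ : 0 < Real.sin β := Real.sin_pos_of_pos_of_lt_pi hβ (by linarith)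
  have sαβ : 0 < Real.sin (α + β) := Real.sin_pos_of_pos_of_lt_pi (by linarith) hs
  set D := a * Real.sin α + b * Real.sin β with hD
  have hDpos : 0 < D := by positivity
  have pα := Real.sin_sq_add_cos_sq α
  have pβ := Real.sin_sq_add_cos_sq β
  set l := b * Real.sin β / D with hl
  set m := a * Real.sin α / D with hm
  have hl0 : 0 ≤ l := by positivity
  have hm0 : 0 ≤ m := by positivity
  have hlm : l + m = 1 := by
    rw [hl, hm, ← add_div, div_eq_one_iff_eq hDpos.ne', hD]
    ring
  have hbal : l * (a * Real.sin α) = m * (b * Real.sin β) := by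
    rw [hl, hm]
    ring
  set t := l * (a * Real.cos α) + m * (b * Real.cos β) with ht
  have ht' : t = a * b * Real.sin (α + β) / D := by
    rw [ht, hl, hm, Real.sin_add]
    ring
  refine ⟨t, by rw [ht']; positivity, ?_, ?_⟩
  · have h1 : a * Real.cos α ≤ max a b :=
      (mul_le_of_le_one_right ha.le (Real.cos_le_one α)).trans (le_max_left _ _)
    have h2 : b * Real.cos β ≤ max a b :=
      (mul_le_of_le_one_right hb.le (Real.cos_le_one β)).trans (le_max_right _ _)
    calc t ≤ l * max a b + m * max a b := by rw [ht]; gcongr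
      _ = max a b := by rw [← add_mul, hlm, one_mul]
  · set E := a ^ 2 + b ^ 2 - 2 * a * b * Real.cos (α + β) with hE
    have e1 : a ^ 2 + t ^ 2 - 2 * a * t * Real.cos α = m ^ 2 * E := by
      have hm1 : m = 1 - l := by linarith
      have key : a ^ 2 + t ^ 2 - 2 * a * t * Real.cos α
          = (t - a * Real.cos α) ^ 2 + (a * Real.sin α) ^ 2 := by
        linear_combination (-a ^ 2) * pα
      have k1 : t - a * Real.cos α = m * (b * Real.cos β - a * Real.cos α) := by
        rw [ht, hm1]; ring
      have k2 : a * Real.sin α = m * (a * Real.sin α + b * Real.sin β) := by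
        rw [mul_add, ← hbal, ← add_mul, add_comm m l, hlm, one_mul]
      rw [key, k1, k2, hE, Real.cos_add]
      linear_combination (m ^ 2 * a ^ 2) * pα + (m ^ 2 * b ^ 2) * pβ
    have e2 : t ^ 2 + b ^ 2 - 2 * t * b * Real.cos β = l ^ 2 * E := by
      have hl1 : l = 1 - m := by linarith
      have key : t ^ 2 + b ^ 2 - 2 * t * b * Real.cos β
          = (t - b * Real.cos β) ^ 2 + (b * Real.sin β) ^ 2 := by
        linear_combination (-b ^ 2) * pβ
      have k1 : t - b * Real.cos β = l * (a * Real.cos α - b * Real.cos β) := by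
        rw [ht, hl1]; ring
      have k2 : b * Real.sin β = l * (a * Real.sin α + b * Real.sin β) := by
        rw [mul_add, hbal, ← add_mul, add_comm m l, hlm, one_mul]
      rw [key, k1, k2, hE, Real.cos_add]
      linear_combination (l ^ 2 * a ^ 2) * pα + (l ^ 2 * b ^ 2) * pβ
    rw [e1, e2, Real.sqrt_mul (sq_nonneg _), Real.sqrt_mul (sq_nonneg _), Real.sqrt_sq hm0,
      Real.sqrt_sq hl0, ← add_mul, add_comm m l, hlm, one_mul]

theorem exists_bound {P : I × I → Prop} (h : ∀ᶠ st in 𝓝[>] (0 : I) ×ˢ 𝓝[>] (0 : I), P st) :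
    ∃ ε : ℝ, 0 < ε ∧ ε ≤ 1 ∧ ∀ s t : I, 0 < s → (s : ℝ) < ε → 0 < t → (t : ℝ) < ε → P (s, t) := by
  obtain ⟨U, hU, V, hV, hUV⟩ := Filter.mem_prod_iff.1 h
  obtain ⟨u, hu, hu'⟩ := (mem_nhdsGT_iff_exists_Ioo_subset' (zero_lt_one (α := I))).1 hU
  obtain ⟨v, hv, hv'⟩ := (mem_nhdsGT_iff_exists_Ioo_subset' (zero_lt_one (α := I))).1 hV
  refine ⟨min u v, lt_min hu hv, (min_le_left _ _).trans u.2.2, fun s t hs hs' ht ht' => ?_⟩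
  exact hUV ⟨hu' ⟨hs, (lt_min_iff.1 hs').1⟩, hv' ⟨ht, (lt_min_iff.1 ht').2⟩⟩

theorem eventually_small {ε : ℝ} (hε : 0 < ε) :
    ∀ᶠ st : I × I in 𝓝[>] (0 : I) ×ˢ 𝓝[>] (0 : I), (st.1 : ℝ) < ε ∧ (st.2 : ℝ) < ε := by
  have : ∀ᶠ s : I in 𝓝[>] (0 : I), (s : ℝ) < ε :=
    nhdsWithin_le_nhds ((continuous_subtype_val.tendsto (0 : I)).eventually_lt_const hε)
  exact this.prod_mk this

theorem dist_lt_of_compAngle_lt {p q r : X} {θ : ℝ} (hq : q ≠ p) (hr : r ≠ p)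
    (hθ : θ ≤ Real.pi) (h : compAngle p q r < θ) :
    dist q r < √(dist p q ^ 2 + dist p r ^ 2 - 2 * dist p q * dist p r * Real.cos θ) := by
  have ha : 0 < dist p q := dist_pos.2 hq.symm
  have hb : 0 < dist p r := dist_pos.2 hr.symm
  apply Real.lt_sqrt_of_sq_lt
  rw [cos_compAngle hq hr]
  have := Real.cos_lt_cos_of_nonneg_of_le_pi (compAngle_nonneg p q r) hθ h
  have : 0 < 2 * dist p q * dist p r := by positivity
  nlinarith

theorem lt_dist_of_lt_compAngle {p q r : X} {θ : ℝ} (hq : q ≠ p) (hr : r ≠ p)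
    (hθ : 0 ≤ θ) (h : θ < compAngle p q r) :
    √(dist p q ^ 2 + dist p r ^ 2 - 2 * dist p q * dist p r * Real.cos θ) < dist q r := by
  have ha : 0 < dist p q := dist_pos.2 hq.symm
  have hb : 0 < dist p r := dist_pos.2 hr.symm
  rw [Real.sqrt_lt' (dist_pos.2 ?_)]
  · rw [cos_compAngle hq hr]
    have := Real.cos_lt_cos_of_nonneg_of_le_pi hθ (compAngle_le_pi p q r) h
    have : 0 < 2 * dist p q * dist p r := by positivity
    nlinarith
  · rintro rfl
    have h0 : compAngle p q q = 0 := by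
      rw [compAngle, if_neg (by tauto), if_neg (by tauto), dist_self, Real.arccos_eq_zero]
      refine le_of_eq ?_
      field_simp
      ring
    linarith

theorem angle_triangle (c₁ c₂ c₃ : NGeod X p) : angle c₁ c₃ ≤ angle c₁ c₂ + angle c₂ c₃ := by
  by_cases h2 : c₂.target = p
  · by_cases h1 : c₁.target = p
    · by_cases h3 : c₃.target = p
      · rw [angle_zero_zero h1 h3]
        exact add_nonneg (angle_nonneg _ _) (angle_nonneg _ _)
      · rw [angle_zero_left h1 h3, angle_zero_left h2 h3]
        linarith [angle_nonneg c₁ c₂]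
    · by_cases h3 : c₃.target = p
      · rw [angle_comm c₁ c₃, angle_zero_left h3 h1, angle_comm c₁ c₂, angle_zero_left h2 h1]
        linarith [angle_nonneg c₂ c₃]
      · rw [angle_comm c₁ c₂, angle_zero_left h2 h1, angle_zero_left h2 h3]
        linarith [angle_le_pi c₁ c₃]
  by_cases h1 : c₁.target = p
  · by_cases h3 : c₃.target = p
    · rw [angle_zero_zero h1 h3]
      exact add_nonneg (angle_nonneg _ _) (angle_nonneg _ _)
    · rw [angle_zero_left h1 h3, angle_zero_left h1 h2]
      linarith [angle_nonneg c₂ c₃]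
  by_cases h3 : c₃.target = p
  · rw [angle_comm c₁ c₃, angle_zero_left h3 h1, angle_comm c₂ c₃, angle_zero_left h3 h2]
    linarith [angle_nonneg c₁ c₂]
  by_contra! hlt
  set δ := (angle c₁ c₃ - angle c₁ c₂ - angle c₂ c₃) / 3 with hδ
  have hδ0 : 0 < δ := by rw [hδ]; linarith
  set α := angle c₁ c₂ + δ with hα
  set β := angle c₂ c₃ + δ with hβ
  have hα0 : 0 < α := by linarith [angle_nonneg c₁ c₂]
  have hβ0 : 0 < β := by linarith [angle_nonneg c₂ c₃]
  have hsum : α + β < angle c₁ c₃ := by linarith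
  have hpi : α + β < Real.pi := hsum.trans_le (angle_le_pi _ _)
  obtain ⟨ε₁, hε₁, hε₁', H₁⟩ := exists_bound
    (eventually_lt_of_limsup_lt (show angle c₁ c₂ < α by linarith) (bdd_above c₁ c₂))
  obtain ⟨ε₂, hε₂, hε₂', H₂⟩ := exists_bound
    (eventually_lt_of_limsup_lt (show angle c₂ c₃ < β by linarith) (bdd_above c₂ c₃))
  have K1 : 0 < dist p c₁.target := dist_pos.2 (Ne.symm h1)
  have K2 : 0 < dist p c₂.target := dist_pos.2 (Ne.symm h2)
  have K3 : 0 < dist p c₃.target := dist_pos.2 (Ne.symm h3)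
  set ε := min ε₁ ε₂ with hε
  have hε0 : 0 < ε := lt_min hε₁ hε₂
  set ε' := min ε (min (ε * dist p c₂.target / dist p c₁.target)
    (ε * dist p c₂.target / dist p c₃.target)) with hε'
  have hε'0 : 0 < ε' := by
    rw [hε']
    refine lt_min hε0 (lt_min ?_ ?_) <;> positivity
  obtain ⟨⟨s, u⟩, hsu, ⟨hs0, hu0⟩, hsε, huε⟩ :=
    ((frequently_lt_of_lt_limsup (cobdd_above c₁ c₃) hsum).and_eventually
      (eventually_pos.and (eventually_small hε'0))).exists
  simp only at hsu hs0 hu0 hsε huε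
  obtain ⟨hs1, hs2⟩ := lt_min_iff.1 hsε
  obtain ⟨hs2, -⟩ := lt_min_iff.1 hs2
  obtain ⟨hu1, hu2⟩ := lt_min_iff.1 huε
  obtain ⟨-, hu2⟩ := lt_min_iff.1 hu2
  rw [lt_div_iff₀ K1] at hs2
  rw [lt_div_iff₀ K3] at hu2
  have d1 := c₁.dist_start s
  have d3 := c₃.dist_start u
  have n1 := c₁.toFun_ne h1 hs0
  have n3 := c₃.toFun_ne h3 hu0
  obtain ⟨t, ht0, htm, hts⟩ := euclid_split (dist_pos.2 n1.symm) (dist_pos.2 n3.symm) hα0 hβ0 hpi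
  have htε : t / dist p c₂.target < ε := by
    rw [div_lt_iff₀ K2]
    refine htm.trans_lt (max_lt ?_ ?_)
    · rw [d1]; linarith
    · rw [d3]; linarith
  have hε1 : ε ≤ 1 := (min_le_left _ _).trans hε₁'
  set τ : I := ⟨t / dist p c₂.target, by positivity, (htε.trans_le hε1).le⟩ with hτ
  have hτ0 : 0 < τ := by
    change (0 : ℝ) < t / dist p c₂.target
    positivity
  have d2 : dist p (c₂.toFun τ) = t := by
    rw [c₂.dist_start]
    change dist p c₂.target * (t / dist p c₂.target) = t
    field_simp
  have n2 := c₂.toFun_ne h2 hτ0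
  have a1 := H₁ s τ hs0 (hs1.trans_le (min_le_left _ _)) hτ0 (htε.trans_le (min_le_left _ _))
  have a2 := H₂ τ u hτ0 (htε.trans_le (min_le_right _ _)) hu0 (hu1.trans_le (min_le_right _ _))
  have b1 := dist_lt_of_compAngle_lt n1 n2 (by linarith) a1
  have b2 := dist_lt_of_compAngle_lt n2 n3 (by linarith) a2
  have b3 := lt_dist_of_lt_compAngle n1 n3 (by linarith) hsu
  rw [d2] at b1 b2
  have := dist_triangle (c₁.toFun s) (c₂.toFun τ) (c₃.toFun u)
  linarith

end AngleFacts

/-- The Alexandrov angle is a pseudometric on the set of normalized geodesics issuing from `p`. -/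
noncomputable instance NGeod.instPseudoMetricSpace {X : Type*} [MetricSpace X] {p : X} :
    PseudoMetricSpace (NGeod X p) where
  dist := angle
  dist_self := angle_self
  dist_comm := angle_comm
  dist_triangle := angle_triangle

/-! ### Tangent spaces -/

/-- The space of directions at `p`: the metric identification of the normalized geodesics issuing
from `p`, with the Alexandrov angle as distance. -/
abbrev Direction (X : Type*) [MetricSpace X] (p : X) : Type _ := SeparationQuotient (NGeod X p)

open Classical in
/-- The zero geodesic indicator `ζ` on directions: `0` for the zero geodesic, `1` otherwise. -/
noncomputable def zeta {X : Type*} [MetricSpace X] {p : X} : Direction X p → ℝ≥0 :=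
  SeparationQuotient.lift (fun c => if c.target = p then 0 else 1) (by
    intro c₁ c₂ h
    have h0 : angle c₁ c₂ = 0 := Metric.inseparable_iff.1 h
    by_cases h1 : c₁.target = p <;> by_cases h2 : c₂.target = p
    · simp [h1, h2]
    · rw [angle_zero_left h1 h2] at h0
      linarith [Real.pi_pos]
    · rw [angle_comm, angle_zero_left h2 h1] at h0
      linarith [Real.pi_pos]
    · simp [h1, h2])

/-- Two pairs of a length and a direction represent the same tangent vector if both have length
zero, or both have the same positive length and the same direction. -/
def tangentSetoid (X : Type*) [MetricSpace X] (p : X) : Setoid (ℝ≥0 × Direction X p) where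
  r v w := (v.1 * zeta v.2 = 0 ∧ w.1 * zeta w.2 = 0) ∨
    (v.1 * zeta v.2 = w.1 * zeta w.2 ∧ 0 < w.1 * zeta w.2 ∧ v.2 = w.2)
  iseqv := by
    refine ⟨fun v => ?_, fun {v w} h => ?_, fun {u v w} h h' => ?_⟩
    · rcases eq_or_ne (v.1 * zeta v.2) 0 with h | h
      · exact Or.inl ⟨h, h⟩
      · exact Or.inr ⟨rfl, pos_iff_ne_zero.2 h, rfl⟩
    · rcases h with ⟨h1, h2⟩ | ⟨h1, h2, h3⟩
      · exact Or.inl ⟨h2, h1⟩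
      · exact Or.inr ⟨h1.symm, h1 ▸ h2, h3.symm⟩
    · rcases h with ⟨h1, h2⟩ | ⟨h1, h2, h3⟩ <;> rcases h' with ⟨k1, k2⟩ | ⟨k1, k2, k3⟩
      · exact Or.inl ⟨h1, k2⟩
      · exact absurd h2 (k1 ▸ k2.ne')
      · exact absurd k1 h2.ne'
      · exact Or.inr ⟨h1.trans k1, k2, h3.trans k3⟩

/-- The tangent space `T_p X` (the Euclidean cone over the space of directions at `p`). -/
def Tangent (X : Type*) [MetricSpace X] (p : X) : Type _ := Quotient (tangentSetoid X p)

/-- The tangent vector `t c` of length `t` in the direction `c`. -/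
def Tangent.mk {X : Type*} [MetricSpace X] {p : X} (t : ℝ≥0) (c : Direction X p) : Tangent X p :=
  Quotient.mk (tangentSetoid X p) (t, c)

theorem zeta_eq_zero_or_one {X : Type*} [MetricSpace X] {p : X} (c : Direction X p) :
    zeta c = 0 ∨ zeta c = 1 := by
  induction c using Quotient.inductionOn with
  | h c =>
    change zeta (SeparationQuotient.mk c) = 0 ∨ zeta (SeparationQuotient.mk c) = 1
    unfold zeta
    rw [SeparationQuotient.lift_mk]
    split_ifs <;> simp

theorem sq_mul_zeta {X : Type*} [MetricSpace X] {p : X} (t : ℝ≥0) (c : Direction X p) :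
    (t : ℝ) ^ 2 * zeta c = ((t * zeta c : ℝ≥0) : ℝ) ^ 2 := by
  rcases zeta_eq_zero_or_one c with h | h <;> simp [h]

/-- The distance `d_p` on the tangent space,
`d_p (t₁ c₁) (t₂ c₂) = √(t₁² ζ(c₁) + t₂² ζ(c₂) - 2 t₁ t₂ ζ(c₁) ζ(c₂) cos ∠(c₁, c₂))`. -/
noncomputable def tangentDist {X : Type*} [MetricSpace X] {p : X} : Tangent X p → Tangent X p → ℝ :=
  Quotient.lift₂ (s₁ := tangentSetoid X p) (s₂ := tangentSetoid X p)
    (fun v w => √((v.1 : ℝ) ^ 2 * zeta v.2 + (w.1 : ℝ) ^ 2 * zeta w.2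
      - 2 * v.1 * w.1 * zeta v.2 * zeta w.2 * Real.cos (dist v.2 w.2)))
    (by
      have key : ∀ v w : ℝ≥0 × Direction X p,
          2 * (v.1 : ℝ) * w.1 * zeta v.2 * zeta w.2 * Real.cos (dist v.2 w.2) =
            2 * ((v.1 * zeta v.2 : ℝ≥0) : ℝ) * ((w.1 * zeta w.2 : ℝ≥0) : ℝ)
              * Real.cos (dist v.2 w.2) := by
        intro v w
        push_cast
        ring
      intro v w v' w' hv hw
      simp only [key, sq_mul_zeta]
      rcases hv with ⟨h1, h2⟩ | ⟨h1, -, h3⟩ <;> rcases hw with ⟨k1, k2⟩ | ⟨k1, -, k3⟩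
      · rw [h1, h2, k1, k2]; simp
      · rw [h1, h2, k1]; simp
      · rw [h1, k1, k2]; simp
      · rw [h1, h3, k1, k3])

/-- The zero tangent vector `0_p`. -/
noncomputable def Tangent.zero {X : Type*} [MetricSpace X] (p : X) : Tangent X p :=
  Tangent.mk 0 (SeparationQuotient.mk (NGeod.zero p))

/-- The norm `‖v‖_p = d_p (0_p, v)`. -/
noncomputable def tangentNorm {X : Type*} [MetricSpace X] {p : X} (v : Tangent X p) : ℝ :=
  tangentDist (Tangent.zero p) v

/-- The product `g_p (v, w) = (‖v‖² + ‖w‖² - d_p (v, w)²) / 2` on the tangent space. -/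
noncomputable def tangentProd {X : Type*} [MetricSpace X] {p : X} (v w : Tangent X p) : ℝ :=
  (1 / 2) * (tangentNorm v ^ 2 + tangentNorm w ^ 2 - tangentDist v w ^ 2)

/-- The tangent vector `t γ_{p,q}` at `p`. -/
noncomputable def tangentVec {X : Type*} [MetricSpace X] [CAT0Space X] (t : ℝ≥0) (p q : X) :
    Tangent X p :=
  Tangent.mk t (SeparationQuotient.mk (geod p q))

/-! ### Vector fields and resolvents -/

/-- A set-valued vector field: a set of tangent vectors at every point. -/
abbrev VectorField (X : Type*) [MetricSpace X] : Type _ := (p : X) → Set (Tangent X p)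

namespace VectorField

variable {X : Type*} [MetricSpace X]

/-- The domain of a vector field. -/
def dom (A : VectorField X) : Set X := {p | (A p).Nonempty}

variable [CAT0Space X]

/-- Monotonicity: `g_p (η, γ_{p,q}) ≤ - g_q (ν, γ_{q,p})` for all `η ∈ A p`, `ν ∈ A q`. -/
def IsMonotone (A : VectorField X) : Prop :=
  ∀ p q : X, ∀ η ∈ A p, ∀ ν ∈ A q,
    tangentProd η (tangentVec 1 p q) ≤ -tangentProd ν (tangentVec 1 q p)

/-- The surjectivity condition: for all `t > 0` and `x` there is `p` with
`t d(p,x) γ_{p,x} ∈ A p`. -/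
def SurjectivityCondition (A : VectorField X) : Prop :=
  ∀ t : ℝ≥0, 0 < t → ∀ x : X, ∃ p : X, tangentVec (t * nndist p x) p x ∈ A p

/-- The `r`-resolvent (for `r > 0`) as a set-valued map:
`J_r x = {z | r⁻¹ d(z,x) γ_{z,x} ∈ A z}`. -/
def resolvent (A : VectorField X) (r : ℝ≥0) (x : X) : Set X :=
  {z | tangentVec (r⁻¹ * nndist z x) z x ∈ A z}

end VectorField

/-- The metric projection as a set-valued map: the set of points of `C` nearest to `x`. -/
def metricProj {X : Type*} [MetricSpace X] (C : Set X) (x : X) : Set X :=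
  {y | y ∈ C ∧ ∀ z ∈ C, dist x y ≤ dist x z}

end Hadamard

/-! In a CAT(0) space an Alexandrov angle is at most the comparison angle, so the law of cosines
bounds `tangentProd` of two geodesic directions below by its Euclidean value
(`le_tangentProd_tangentVec`). Put into monotonicity, this has two consequences. For two points of
the same resolvent set the distances to `x` cancel and the points coincide. For `z = J_r x`, `p` in
the domain and `ν ∈ A p`, with the second product bounded by Cauchy-Schwarz, it gives d(z,x)² +
d(z,p)² ≤ d(x,p)² + 2 r ‖ν‖ d(z,p) (`IsMonotone.dist_resolvent_le`).

Since `z` lies in the domain, d(z,x) is at least the distance D from `x` to the domain. Taking `p`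
almost nearest to `x` and then `r` small therefore traps all `J_r x` in a small ball about `p`, so
`J_r x` is Cauchy as r → 0⁺. In the limit `z` the error term vanishes and d(z,x)² + d(z,p)² ≤
d(x,p)² for every `p` in the closure of the domain. This Pythagorean inequality makes `z` the unique
nearest point; convexity of the closure is not needed. -/

namespace Hadamard

/-! ### Norm and product on the tangent cone -/

section TangentSpace

variable {X : Type*} [MetricSpace X] {p : X}

theorem tangentDist_mk (s t : ℝ≥0) (c d : Direction X p) :
    tangentDist (Tangent.mk s c) (Tangent.mk t d) =
      √((s : ℝ) ^ 2 * zeta c + (t : ℝ) ^ 2 * zeta d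
        - 2 * s * t * zeta c * zeta d * Real.cos (dist c d)) :=
  rfl

theorem tangentNorm_mk (t : ℝ≥0) (c : Direction X p) :
    tangentNorm (Tangent.mk t c) = t * zeta c := by
  rw [tangentNorm, Tangent.zero, tangentDist_mk, sq_mul_zeta t c]
  simpa using Real.sqrt_sq (NNReal.coe_nonneg (t * zeta c))

theorem tangentProd_mk (s t : ℝ≥0) (c d : Direction X p) :
    tangentProd (Tangent.mk s c) (Tangent.mk t d) =
      s * t * zeta c * zeta d * Real.cos (dist c d) := by
  have hu : (0 : ℝ) ≤ (s * zeta c : ℝ≥0) := NNReal.coe_nonneg _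
  have hv : (0 : ℝ) ≤ (t * zeta d : ℝ≥0) := NNReal.coe_nonneg _
  rw [tangentProd, tangentNorm_mk, tangentNorm_mk, tangentDist_mk, Real.sq_sqrt,
    sq_mul_zeta, sq_mul_zeta]
  · push_cast
    ring
  -- With lengths u, v the radicand is (u - v)² + 2uv(1 - cos), hence nonnegative.
  · rw [sq_mul_zeta, sq_mul_zeta]
    push_cast at hu hv ⊢
    nlinarith [mul_nonneg (mul_nonneg hu hv) (sub_nonneg.2 (Real.cos_le_one (dist c d))),
      sq_nonneg ((s : ℝ) * zeta c - t * zeta d)]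

/-- Cauchy-Schwarz against a vector of norm 0 or 1, from cos ≥ -1. Through it, an element of `A p`
enters the resolvent estimate only by its norm. -/
theorem neg_tangentNorm_le_tangentProd (v : Tangent X p) (d : Direction X p) :
    -tangentNorm v ≤ tangentProd v (Tangent.mk 1 d) := by
  induction v using Quotient.inductionOn with
  | h v =>
    obtain ⟨t, c⟩ := v
    change -tangentNorm (Tangent.mk t c) ≤ tangentProd (Tangent.mk t c) (Tangent.mk 1 d)
    rw [tangentNorm_mk, tangentProd_mk]
    have h : (0 : ℝ) ≤ t * zeta c := by positivity
    have hcos := Real.neg_one_le_cos (dist c d)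
    rcases zeta_eq_zero_or_one d with hd | hd
    · simpa [hd] using h
    · rw [hd, NNReal.coe_one, mul_one, mul_one]
      nlinarith

end TangentSpace

/-! ### Euclidean comparison and first variation -/

/-- A triangle in the Euclidean plane with two given sides and a given angle between them. -/
theorem exists_euclid_triangle (a b θ : ℝ) :
    ∃ q r : EuclideanSpace ℝ (Fin 2), ∀ s t : ℝ,
      dist (AffineMap.lineMap 0 q s : EuclideanSpace ℝ (Fin 2)) (AffineMap.lineMap 0 r t) =
        √((s * a) ^ 2 + (t * b) ^ 2 - 2 * (s * a) * (t * b) * Real.cos θ) := by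
  refine ⟨!₂[a, 0], !₂[b * Real.cos θ, b * Real.sin θ], fun s t => ?_⟩
  rw [EuclideanSpace.dist_eq]
  congr 1
  simp [AffineMap.lineMap_apply, Fin.sum_univ_two, Real.dist_eq, sq_abs]
  linear_combination (t * b) ^ 2 * Real.sin_sq_add_cos_sq θ

section CAT0

variable {X : Type*} [MetricSpace X] [CAT0Space X]

theorem geod_target (p q : X) : (geod p q).target = q :=
  (CAT0Space.exists_geodesic p q).choose_spec

/-- Comparison angles along two geodesics of a CAT(0) space are at most the one between the end
points. -/
theorem compAngle_le_compAngle_target {p : X} (c₁ c₂ : NGeod X p) (h₁ : c₁.target ≠ p)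
    (h₂ : c₂.target ≠ p) {s t : I} (hs : 0 < s) (ht : 0 < t) :
    compAngle p (c₁.toFun s) (c₂.toFun t) ≤ compAngle p c₁.target c₂.target := by
  set θ := compAngle p c₁.target c₂.target with hθ
  obtain ⟨q', r', hqr⟩ := exists_euclid_triangle (dist p c₁.target) (dist p c₂.target) θ
  -- The parameters (1,0), (0,1) and (1,1) in `hqr` give the three side lengths, so this is a
  -- comparison triangle.
  have hq : dist 0 q' = dist p c₁.target := by
    have h := hqr 1 0
    rw [AffineMap.lineMap_apply_one, AffineMap.lineMap_apply_zero] at h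
    rw [dist_comm, h]
    simp
  have hr : dist r' 0 = dist c₂.target p := by
    have h := hqr 0 1
    rw [AffineMap.lineMap_apply_one, AffineMap.lineMap_apply_zero] at h
    rw [dist_comm, h, dist_comm c₂.target]
    simp
  have hqr' : dist q' r' = dist c₁.target c₂.target := by
    have h := hqr 1 1
    rw [AffineMap.lineMap_apply_one, AffineMap.lineMap_apply_one, one_mul, one_mul,
      ← cos_compAngle h₁ h₂, Real.sqrt_sq dist_nonneg] at h
    exact h
  have key := CAT0Space.thin p _ _ c₁ c₂ rfl rfl 0 q' r' hq hqr' hr s t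
  have ds := c₁.dist_start s
  have dt := c₂.dist_start t
  rw [hqr, mul_comm (s : ℝ), mul_comm (t : ℝ), ← ds, ← dt] at key
  -- A comparison angle above `θ` would, by the law of cosines, push the distance strictly beyond
  -- the Euclidean one, against thinness.
  refine le_of_not_gt fun hlt => ?_
  exact (lt_dist_of_lt_compAngle (c₁.toFun_ne h₁ hs) (c₂.toFun_ne h₂ ht)
    (compAngle_nonneg _ _ _) hlt).not_ge key

theorem angle_le_compAngle {p : X} (c₁ c₂ : NGeod X p) (h₁ : c₁.target ≠ p)
    (h₂ : c₂.target ≠ p) : angle c₁ c₂ ≤ compAngle p c₁.target c₂.target := by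
  refine limsup_le_of_le (cobdd_above c₁ c₂) ?_
  filter_upwards [eventually_pos] with st hst
  exact compAngle_le_compAngle_target c₁ c₂ h₁ h₂ hst.1 hst.2

theorem zeta_geod_of_ne {p q : X} (h : q ≠ p) :
    zeta (SeparationQuotient.mk (geod p q)) = 1 := by
  unfold zeta
  rw [SeparationQuotient.lift_mk, if_neg (by rwa [geod_target])]

theorem zeta_geod_self (p : X) : zeta (SeparationQuotient.mk (geod p p)) = 0 := by
  unfold zeta
  rw [SeparationQuotient.lift_mk, if_pos (geod_target p p)]

/-- First variation inequality: the product of `k d(z,x) γ_{z,x}` and `γ_{z,w}` is bounded below by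
its Euclidean comparison value. -/
theorem le_tangentProd_tangentVec (k : ℝ≥0) (z x w : X) :
    k * (dist z x ^ 2 + dist z w ^ 2 - dist x w ^ 2) ≤
      2 * dist z w * tangentProd (tangentVec (k * nndist z x) z x) (tangentVec 1 z w) := by
  rw [tangentVec, tangentVec, tangentProd_mk]
  -- If `x = z` or `w = z`, both sides vanish; the law of cosines needs both different from `z`.
  rcases eq_or_ne x z with rfl | hx
  · simp
  rcases eq_or_ne w z with rfl | hw
  · simp [dist_comm]
  rw [zeta_geod_of_ne hx, zeta_geod_of_ne hw, SeparationQuotient.dist_mk]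
  have hle := angle_le_compAngle (geod z x) (geod z w) (by rwa [geod_target])
    (by rwa [geod_target])
  rw [geod_target, geod_target] at hle
  -- Cosine reverses the angle comparison, which turns it into a lower bound for the product.
  have hcos := Real.cos_le_cos_of_nonneg_of_le_pi (angle_nonneg (geod z x) (geod z w))
    (compAngle_le_pi z x w) hle
  have hlaw := cos_compAngle hx hw
  change _ ≤ 2 * dist z w * (_ * Real.cos (angle (geod z x) (geod z w)))
  push_cast
  rw [hlaw]
  have h : (0 : ℝ) ≤ 2 * k * dist z x * dist z w := by positivity
  linear_combination mul_le_mul_of_nonneg_left hcos h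

/-! ### Resolvents of monotone vector fields -/

namespace VectorField

variable {A : VectorField X}

theorem resolvent_subset_dom (A : VectorField X) (r : ℝ≥0) (x : X) : A.resolvent r x ⊆ A.dom :=
  fun _ hz => ⟨_, hz⟩

/-- Adding the first variation inequalities at `z` and at `w` cancels the distances to `x` and
leaves 2 r⁻¹ d(z,w)² on the left, while monotonicity makes the right side nonpositive. -/
theorem IsMonotone.resolvent_subsingleton (hmono : A.IsMonotone) {r : ℝ≥0} (hr : 0 < r) (x : X) :
    (A.resolvent r x).Subsingleton := by
  intro z hz w hw
  have hm := hmono z w _ hz _ hw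
  have h₁ := le_tangentProd_tangentVec r⁻¹ z x w
  have h₂ := le_tangentProd_tangentVec r⁻¹ w x z
  rw [dist_comm w z, dist_comm x z] at h₂
  rw [dist_comm x w] at h₁
  have hk : (0 : ℝ) < (r⁻¹ : ℝ≥0) := by exact_mod_cast inv_pos.2 hr
  have hd : (0 : ℝ) ≤ 2 * dist z w := by positivity
  have hsum : (r⁻¹ : ℝ≥0) * (2 * dist z w ^ 2) ≤ 0 := by
    have := mul_le_mul_of_nonneg_left hm hd
    linarith
  have hsq : dist z w ^ 2 ≤ 0 := by
    by_contra hpos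
    nlinarith [mul_pos hk (not_le.1 hpos)]
  exact dist_eq_zero.1 (pow_eq_zero_iff two_ne_zero |>.1 (le_antisymm hsq (sq_nonneg _)))

theorem SurjectivityCondition.resolvent_nonempty (hsurj : A.SurjectivityCondition) {r : ℝ≥0}
    (hr : 0 < r) (x : X) : (A.resolvent r x).Nonempty :=
  hsurj r⁻¹ (inv_pos.2 hr) x

/-- Comparison of a resolvent point with a point of the domain. -/
theorem IsMonotone.dist_resolvent_le (hmono : A.IsMonotone) {r : ℝ≥0} (hr : 0 < r) {x z p : X}
    (hz : z ∈ A.resolvent r x) {ν : Tangent X p} (hν : ν ∈ A p) :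
    dist z x ^ 2 + dist z p ^ 2 ≤ dist x p ^ 2 + 2 * r * tangentNorm ν * dist z p := by
  have hm := hmono z p _ hz ν hν
  have h := le_tangentProd_tangentVec r⁻¹ z x p
  have hN : -tangentNorm ν ≤ tangentProd ν (tangentVec 1 p z) :=
    neg_tangentNorm_le_tangentProd _ _
  have hd : (0 : ℝ) ≤ 2 * dist z p := by positivity
  have hr' : (0 : ℝ) < r := hr
  have h' := h.trans (mul_le_mul_of_nonneg_left (hm.trans (neg_le.1 hN)) hd)
  rw [NNReal.coe_inv, inv_mul_le_iff₀ hr'] at h'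
  linarith

end VectorField

end CAT0

end Hadamard

/-! ### Convergence to the nearest point -/

theorem theorem4p9 {H : Type*} [MetricSpace H] [CompleteSpace H] [Hadamard.CAT0Space H]
    (hext : Hadamard.GeodesicExtension H) (A : Hadamard.VectorField H)
    (hmono : A.IsMonotone) (hsurj : A.SurjectivityCondition) (x : H) :
    ∃ (J : ℝ≥0 → H) (z : H),
      (∀ r : ℝ≥0, 0 < r → A.resolvent r x = {J r}) ∧
      Hadamard.metricProj (closure A.dom) x = {z} ∧
      Tendsto J (𝓝[>] 0) (𝓝 z) := by
  have hex : ∀ r : ℝ≥0, ∃ z, 0 < r → z ∈ A.resolvent r x := fun r => by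
    rcases eq_or_ne r 0 with rfl | hr
    -- The value at `r = 0` is arbitrary: the limit is taken along `r > 0`.
    · exact ⟨x, fun h => absurd h (lt_irrefl _)⟩
    · obtain ⟨z, hz⟩ := hsurj.resolvent_nonempty (pos_iff_ne_zero.2 hr) x
      exact ⟨z, fun _ => hz⟩
  choose J hJ using hex
  have hpos : ∀ᶠ r : ℝ≥0 in 𝓝[>] 0, 0 < r := eventually_mem_nhdsWithin
  have hcoe : Tendsto (fun r : ℝ≥0 => (r : ℝ)) (𝓝[>] 0) (𝓝 0) :=
    (NNReal.continuous_coe.tendsto 0).mono_left nhdsWithin_le_nhds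
  have hne : A.dom.Nonempty := ⟨J 1, A.resolvent_subset_dom 1 x (hJ 1 one_pos)⟩
  -- Cauchyness through a common centre: it avoids comparing two resolvent points with different
  -- parameters.
  have hnear : ∀ ε > 0, ∃ p, ∀ᶠ r in 𝓝[>] (0 : ℝ≥0), dist (J r) p < ε := by
    intro ε hε
    set D := Metric.infDist x A.dom with hD
    have hD0 : 0 ≤ D := Metric.infDist_nonneg
    -- The slack is ε² in the squared distance, because the estimate controls d(J r, p)² by d(x,p)²
    -- - D² up to a term of order `r`.
    have hlt : D < √(D ^ 2 + ε ^ 2) := Real.lt_sqrt_of_sq_lt (by nlinarith)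
    obtain ⟨p, ⟨ν, hν⟩, hp⟩ := (Metric.infDist_lt_iff hne).1 hlt
    rw [Real.lt_sqrt dist_nonneg] at hp
    refine ⟨p, ?_⟩
    have hlim : Tendsto (fun r : ℝ≥0 => dist x p ^ 2 - D ^ 2
        + 2 * (r : ℝ) * Hadamard.tangentNorm ν * ε) (𝓝[>] 0) (𝓝 (dist x p ^ 2 - D ^ 2)) := by
      have := ((hcoe.const_mul 2).mul_const (Hadamard.tangentNorm ν)).mul_const ε
      simpa using this.const_add (dist x p ^ 2 - D ^ 2)
    have hlim' : Tendsto (fun r : ℝ≥0 => 2 * (r : ℝ) * Hadamard.tangentNorm ν)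
        (𝓝[>] 0) (𝓝 0) := by
      simpa using (hcoe.const_mul 2).mul_const (Hadamard.tangentNorm ν)
    filter_upwards [hpos, hlim.eventually_lt_const (show _ < ε ^ 2 by linarith),
      hlim'.eventually_lt_const hε] with r hr h₁ h₂
    have hle := hmono.dist_resolvent_le hr (hJ r hr) hν
    have hDr : D ≤ dist (J r) x := by
      rw [dist_comm]
      exact Metric.infDist_le_dist_of_mem (A.resolvent_subset_dom r x (hJ r hr))
    have hDr' : D ^ 2 ≤ dist (J r) x ^ 2 := pow_le_pow_left₀ hD0 hDr 2
    by_contra! hge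
    -- With d = d(J r, p) ≥ ε and N = ‖ν‖, (d - ε)(d + ε - 2rN) ≥ 0 says d² - 2rNd ≥ ε² - 2rNε. By
    -- `h₁` the right side exceeds d(x,p)² - D², whereas `hle` and `hDr'` bound the left side by it.
    nlinarith [mul_nonneg (sub_nonneg.2 hge)
      (show (0 : ℝ) ≤ dist (J r) p + ε - 2 * r * Hadamard.tangentNorm ν by linarith)]
  have hcauchy : Cauchy (map J (𝓝[>] 0)) := by
    refine Metric.cauchy_iff.2 ⟨inferInstance, fun ε hε => ?_⟩
    obtain ⟨p, hp⟩ := hnear (ε / 2) (half_pos hε)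
    exact ⟨Metric.ball p (ε / 2), hp, fun a ha b hb => by
      linarith [dist_triangle_right a b p, Metric.mem_ball.1 ha, Metric.mem_ball.1 hb]⟩
  obtain ⟨z, hz⟩ := CompleteSpace.complete hcauchy
  have hz : Tendsto J (𝓝[>] 0) (𝓝 z) := hz
  have hzdom : z ∈ closure A.dom := mem_closure_of_tendsto hz <| by
    filter_upwards [hpos] with r hr using A.resolvent_subset_dom r x (hJ r hr)
  have hpyth : ∀ p ∈ closure A.dom, dist z x ^ 2 + dist z p ^ 2 ≤ dist x p ^ 2 := by
    have hclosed : IsClosed {p | dist z x ^ 2 + dist z p ^ 2 ≤ dist x p ^ 2} :=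
      isClosed_le (by fun_prop) (by fun_prop)
    -- A boundary point may carry no `ν`, so `r` goes to 0 first at points of the domain; closedness
    -- then reaches the closure.
    refine fun p hp => closure_minimal (fun q hq => ?_) hclosed hp
    obtain ⟨ν, hν⟩ := hq
    have hzq := hz.dist (tendsto_const_nhds (x := q))
    have hzx := hz.dist (tendsto_const_nhds (x := x))
    have hlim : Tendsto (fun r : ℝ≥0 =>
        dist x q ^ 2 + 2 * (r : ℝ) * Hadamard.tangentNorm ν * dist (J r) q)
        (𝓝[>] 0) (𝓝 (dist x q ^ 2)) := by
      simpa using (((hcoe.const_mul 2).mul_const (Hadamard.tangentNorm ν)).mul hzq).const_add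
        (dist x q ^ 2)
    refine le_of_tendsto_of_tendsto ((hzx.pow 2).add (hzq.pow 2)) hlim ?_
    filter_upwards [hpos] with r hr using hmono.dist_resolvent_le hr (hJ r hr) hν
  refine ⟨J, z, fun r hr => ?_, ?_, hz⟩
  · exact (hmono.resolvent_subsingleton hr x).eq_singleton_of_mem (hJ r hr)
  · refine Set.eq_singleton_iff_unique_mem.2 ⟨⟨hzdom, fun p hp => ?_⟩, fun y hy => ?_⟩
    · refine le_of_sq_le_sq ?_ dist_nonneg
      rw [dist_comm x z]
      linarith [hpyth p hp, sq_nonneg (dist z p)]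
    -- A nearest `y` has d(x,y) ≤ d(x,z), which leaves no room for d(z,y)² in `hpyth`.
    · have h₁ := pow_le_pow_left₀ dist_nonneg (hy.2 z hzdom) 2
      have h₂ := hpyth y hy.1
      rw [dist_comm x z] at h₁
      have h₃ : dist z y ^ 2 = 0 := le_antisymm (by linarith) (sq_nonneg _)
      exact (dist_eq_zero.1 (pow_eq_zero_iff two_ne_zero |>.1 h₃)).symm
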